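/- Let $G$ be a finite, connected, directed multigraph (loops and multiple edges allowed) embedded in the oriented plane, with vertex set $V$, edge set $E$ and set $\mathcal F$ of bounded faces. Let $a\colon E\to\mathbb C$, and label each edge $e$ by $\ell(e)=(x+a_ey)^2\in\mathbb C[x,y]$. For $F\in\mathcal F$ and $e\in E$ put $\varepsilon_{F,e}=1$ if $e$ points clockwise around $F$, $\varepsilon_{F,e}=-1$ if it points counterclockwise around $F$, and $\varepsilon_{F,e}=0$ if $e$ is not on the boundary of $F$ or has $F$ on both of its sides. The extended cycle basis matrix $M^{\mathsf{ext}}_G$ is the $3|\mathcal F|\times|E|$ matrix that has, for each $F$, three rows with entries $\varepsilon_{F,e}$, $\varepsilon_{F,e}a_e$, $\varepsilon_{F,e}a_e^2$ in column $e$. For $v_0\in V$ let $\mathrm{Spl}_2(G,\ell;v_0)$ be the complex vector space of all maps $p$ from $V$ to the homogeneous polynomials of degree $2$ in $\mathbb C[x,y]$ (including $0$) such that $p(v_0)=0$ and $\ell(e)$ divides $p(u)-p(v)$ for every edge $e$ from $u$ to $v$. Let $S\subseteq\mathcal F$ be a set of $f'$ bounded faces, and let $G'$ be the subgraph that consists of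 these faces, with the vertices and the $e'$ edges on their boundaries. Let $M^{\mathsf{ext}}_{G'}$ be the $3f'\times e'$ submatrix of $M^{\mathsf{ext}}_G$ with the rows of the faces in $S$ and the columns of the edges of $G'$. Let $G\backslash G'$ be the contraction of $G$ along $G'$: the endpoints of every edge of $G'$ are identified, the edges of $G'$ are removed, and all other edges keep their directions and labels. Assume that $e'\le 3f'$ and that the edge labels of $G'$ are generic and not in special position, that is, for $d=\min\{e',3f'\}$ there is a $d\times d$ submatrix of $M^{\mathsf{ext}}_{G'}$ whose determinant is not identically zero as a polynomial in indeterminates $a_e$ and does not vanish at the given values $a_e$. Then the following hold. 1. After ordering the rows (faces in $S$ first) and the columns (edges of $G'$ first), $$M^{\mathsf{ext}}_G=\begin{pmatrix}M^{\mathsf{ext}}_{G'}&0\\ *&D\end{pmatrix},$$ where $D$ is the submatrix of $M^{\mathsf{ext}}_G$ with the rows of the bounded faces not in $S$ and the columns of the edges not in $G'$; and $\operatorname{rank}M^{\mathsf{ext}}_G=\operatorname{rank}M^{\mathsf{ext}}_{G'}+\operatorname{rank}D$. 2. For every plane embedding of the contracted graph $G\backslash G'$, its extended cycle basis matrix satisfies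 $$\operatorname{rank}M^{\mathsf{ext}}_G=\operatorname{rank}M^{\mathsf{ext}}_{G'}+\operatorname{rank}M^{\mathsf{ext}}_{G\backslash G'}.$$ 3. For every $v_0\in V$, denoting its image in $G\backslash G'$ also by $v_0$, $$\dim\mathrm{Spl}_2(G,\ell;v_0)=\dim\mathrm{Spl}_2(G\backslash G',\ell;v_0).$$ -/

import Mathlib

/-- A directed multigraph with vertex type `V` and edge type `E`; loops and multiple edges are
allowed. -/
structure DirectedMultigraph (V E : Type*) where
  /-- The initial vertex of an edge. -/
  src : E → V
  /-- The terminal vertex of an edge. -/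
  tgt : E → V

namespace DirectedMultigraph

variable {V E : Type*}

/-- Connectedness of the underlying undirected graph (nonempty, any two vertices are joined by a
walk that may use edges in either direction). -/
def Connected (G : DirectedMultigraph V E) : Prop :=
  Nonempty V ∧ ∀ u v : V, Relation.EqvGen (fun x y => ∃ e, G.src e = x ∧ G.tgt e = y) u v

/-- The darts (oriented edges) are the pairs `(e, b)`: `(e, true)` is `e` traversed along its
direction, `(e, false)` is `e` traversed against it. This is the vertex at which a dart starts. -/
def origin (G : DirectedMultigraph V E) (d : E × Bool) : V :=
  if d.2 then G.src d.1 else G.tgt d.1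

/-- Reversal of darts. -/
def rev : Equiv.Perm (E × Bool) :=
  Equiv.prodCongr (Equiv.refl E) Equiv.boolNot

/-- An embedding into the oriented plane of a connected multigraph `G`, with `F` as its set of
bounded faces, given combinatorially by its rotation system.

* `rot` sends a dart to the next dart in counterclockwise order around its initial vertex.
* Consequently `rev` followed by `rot` sends a dart to the next dart on the boundary walk of the
  face that lies to its right; the orbits of this permutation are the (boundary walks of the)
  faces.
* `face d` is the face to the right of the dart `d`, with `none` standing for the unbounded face.
  Thus the boundary walk of a bounded face, as given by the darts with that face to their right,
  is traversed clockwise.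
* `euler` is Euler's formula `|V| - |E| + (|F| + 1) = 2`, that is, the surface obtained by glueing
  a disc along each boundary walk is the sphere.

If `G` is a single vertex without edges, then there are no darts, and the unbounded face is the
only face. -/
structure PlaneEmbedding (G : DirectedMultigraph V E) (F : Type*) where
  connected : G.Connected
  rot : Equiv.Perm (E × Bool)
  rot_sameCycle_iff : ∀ d d', rot.SameCycle d d' ↔ G.origin d = G.origin d'
  face : E × Bool → Option F
  face_sameCycle_iff : ∀ d d', (rot * rev).SameCycle d d' ↔ face d = face d'
  exists_face_eq_some : ∀ f : F, ∃ d, face d = some f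
  exists_face_eq_none : Nonempty E → ∃ d, face d = none
  euler : Nat.card V + Nat.card F = Nat.card E + 1

namespace PlaneEmbedding

variable {F R : Type*} [DecidableEq F] [CommRing R] {G : DirectedMultigraph V E}

/-- The cycle basis matrix, with rows indexed by the bounded faces: the entry at `(f, e)` is `1`
if `e` points clockwise around `f`, `-1` if it points counterclockwise around `f`, and `0` if `e`
is not on the boundary of `f`. (An edge that has `f` on both of its sides is traversed once in each
direction by the boundary walk of `f`; its entry is `1 - 1 = 0`.) -/
def cycleMatrix (P : G.PlaneEmbedding F) : Matrix F E ℤ := fun f e =>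
  (if P.face (e, true) = some f then 1 else 0) - (if P.face (e, false) = some f then 1 else 0)

/-- The extended cycle basis matrix for the edge labels `(x + a e * y) ^ 2`: the entry `ε` of the
cycle basis matrix at `(f, e)` is replaced by the three entries `ε`, `ε * a e`, `ε * (a e) ^ 2`
in the three rows that belong to `f`. -/
def extMatrix (P : G.PlaneEmbedding F) (a : E → R) : Matrix (F × Fin 3) E R := fun i e =>
  (P.cycleMatrix i.1 e : R) * a e ^ (i.2 : ℕ)

/-- The edges of the subgraph `G'` formed by a set `S` of bounded faces: all edges that have a
face of `S` on at least one of their sides. -/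
def boundaryEdges [Fintype E] (P : G.PlaneEmbedding F) (S : Finset F) : Finset E :=
  Finset.univ.filter fun e => ∃ f ∈ S, ∃ b : Bool, P.face (e, b) = some f

/-- The extended cycle basis matrix of the subgraph `G'` formed by the faces in `S`: the submatrix
of the extended cycle basis matrix of `G` with the rows of the faces in `S` and the columns of the
edges of `G'`. -/
def innerBlock [Fintype E] (P : G.PlaneEmbedding F) (S : Finset F) (a : E → R) :
    Matrix ({f // f ∈ S} × Fin 3) {e // e ∈ P.boundaryEdges S} R :=
  (P.extMatrix a).submatrix (Prod.map Subtype.val id) Subtype.val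

/-- The complementary diagonal block: the submatrix of the extended cycle basis matrix of `G` with
the rows of the bounded faces outside `S` and the columns of the edges outside `G'`. -/
def outerBlock [Fintype E] (P : G.PlaneEmbedding F) (S : Finset F) (a : E → R) :
    Matrix ({f // f ∉ S} × Fin 3) {e // e ∉ P.boundaryEdges S} R :=
  (P.extMatrix a).submatrix (Prod.map Subtype.val id) Subtype.val

/-- The edge labels `(x + a e * y) ^ 2` of the subgraph `G'` formed by the faces in `S` are generic
(and not in special position): with `d = min e' (3 f')`, some `d × d` submatrix of the extended
cycle basis matrix of `G'` has a determinant which is not identically zero as a polynomial in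
indeterminate labels, and the actual labels `a` are not a root of this polynomial. -/
def GenericLabels [Fintype E] (P : G.PlaneEmbedding F) (S : Finset F) (a : E → R) : Prop :=
  ∃ (r : Fin (min (P.boundaryEdges S).card (3 * S.card)) ↪ {f // f ∈ S} × Fin 3)
    (c : Fin (min (P.boundaryEdges S).card (3 * S.card)) ↪ {e // e ∈ P.boundaryEdges S}),
    ((P.innerBlock S (MvPolynomial.X : E → MvPolynomial E R)).submatrix r c).det ≠ 0 ∧
      MvPolynomial.eval a
        ((P.innerBlock S (MvPolynomial.X : E → MvPolynomial E R)).submatrix r c).det ≠ 0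

end PlaneEmbedding

/-- The vertices of the contraction of `G` along a set `T` of edges: the two endpoints of each edge
in `T` are identified (`Quot` takes the generated equivalence relation), so each connected component
of the subgraph formed by `T` becomes one vertex, and all other vertices stay as they are. -/
abbrev ContractVertex (G : DirectedMultigraph V E) (T : Finset E) : Type _ :=
  Quot fun u v : V => ∃ e ∈ T, G.src e = u ∧ G.tgt e = v

/-- The contraction of `G` along a set `T` of edges. Its edges are the edges of `G` outside `T`,
with their directions; they may become loops or parallel edges. -/
def contract (G : DirectedMultigraph V E) (T : Finset E) :
    DirectedMultigraph (G.ContractVertex T) {e // e ∉ T} where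
  src e := Quot.mk _ (G.src e)
  tgt e := Quot.mk _ (G.tgt e)

/-- `p` is a spline on the edge-labelled graph `(G, ℓ)`. -/
def IsSpline {R : Type*} [CommRing R] (G : DirectedMultigraph V E) (ℓ : E → R) (p : V → R) : Prop :=
  ∀ e, ℓ e ∣ p (G.src e) - p (G.tgt e)

/-- The space `Spl_d(G, ℓ; v₀)` of homogeneous splines of degree `d` on `(G, ℓ)` (each `p v` is zero
or homogeneous of degree `d`) that vanish at `v₀`. It is the complement of the constant splines
among the homogeneous splines of degree `d`. -/
def splineSpace {K : Type*} [CommRing K] (G : DirectedMultigraph V E) (d : ℕ)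
    (ℓ : E → MvPolynomial (Fin 2) K) (v₀ : V) : Submodule K (V → MvPolynomial (Fin 2) K) where
  carrier := {p | (∀ v, (p v).IsHomogeneous d) ∧ G.IsSpline ℓ p ∧ p v₀ = 0}
  zero_mem' := ⟨fun _ => MvPolynomial.isHomogeneous_zero _ _ _, fun e => by simp, rfl⟩
  add_mem' := by
    rintro p q ⟨hp, hp', hp0⟩ ⟨hq, hq', hq0⟩
    refine ⟨fun v => (hp v).add (hq v), fun e => ?_, by simp [hp0, hq0]⟩
    have h := dvd_add (hp' e) (hq' e)
    rwa [show p (G.src e) - p (G.tgt e) + (q (G.src e) - q (G.tgt e))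
      = (p + q) (G.src e) - (p + q) (G.tgt e) by simp only [Pi.add_apply]; ring] at h
  smul_mem' := by
    rintro c p ⟨hp, hp', hp0⟩
    refine ⟨fun v => ?_, fun e => ?_, by simp [hp0]⟩
    · rw [Pi.smul_apply, MvPolynomial.smul_eq_C_mul]
      simpa using (MvPolynomial.isHomogeneous_C (Fin 2) c).mul (hp v)
    · have h := (hp' e).mul_left (MvPolynomial.C c)
      rwa [mul_sub, ← MvPolynomial.smul_eq_C_mul, ← MvPolynomial.smul_eq_C_mul] at h

/-- The homogeneous edge labels `(x + a e * y) ^ 2` in the polynomial ring in `x, y`. -/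
noncomputable def squareLabel {K : Type*} [CommRing K] (a : E → K) (e : E) :
    MvPolynomial (Fin 2) K :=
  (MvPolynomial.X 0 + MvPolynomial.C (a e) * MvPolynomial.X 1) ^ 2

end DirectedMultigraph

/-!
Write `(p u - p v) / (x + a e y) ^ 2 = c e` for the edges `e` from `u` to `v`. Comparing the
coefficients of `x ^ 2`, `2 x y` and `y ^ 2` shows that a quadratic spline vanishing at `v₀` is the
same thing as an edge vector `c` such that `c`, `c a` and `c a ^ 2` are coboundaries. On a plane
graph, coboundaries are the kernel of the cycle matrix (the boundaries of the bounded faces are a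
basis of the cycle space), so these vectors `c` form the kernel of the extended cycle basis matrix.

An edge vector on a contraction `G / T` is a coboundary if and only if its extension by zero is one
on `G`. Hence the vectors `c` for `G / T` are the vectors `c` for `G` that vanish on `T`. On a plane
graph with `T` the edges of `G'`, these also form the kernel of the block `D`, because the rows of
the faces of `G'` vanish outside `T`. If the columns of the block of `G'` are independent, then
every `c` vanishes on `T`, and the contraction loses nothing.
-/

section LinearAlgebra

theorem finrank_comap_eq_of_le_range {R M N : Type*} [Ring R] [AddCommGroup M] [Module R M]
    [AddCommGroup N] [Module R N] {f : M →ₗ[R] N} (hf : Function.Injective f) {W : Submodule R N}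
    (hW : W ≤ LinearMap.range f) : Module.finrank R (W.comap f) = Module.finrank R W := by
  rw [(Submodule.equivMapOfInjective f hf _).finrank_eq, Submodule.map_comap_eq_of_le hW]

variable {m n : Type*}

theorem rank_add_finrank_ker_mulVecLin {K : Type*} [Field K] [Fintype n] (A : Matrix m n K) :
    A.rank + Module.finrank K (LinearMap.ker A.mulVecLin) = Fintype.card n := by
  rw [Matrix.rank, LinearMap.finrank_range_add_finrank_ker, Module.finrank_pi]

theorem rank_eq_card_of_linearIndependent_col {R : Type*} [CommRing R] [Nontrivial R] [Fintype n]
    {A : Matrix m n R} (hA : LinearIndependent R A.col) : A.rank = Fintype.card n := by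
  rw [Matrix.rank_eq_finrank_span_cols, finrank_span_eq_card hA]

theorem linearIndependent_col_of_det_submatrix_ne_zero {k R : Type*} [CommRing R] [IsDomain R]
    [Fintype k] [DecidableEq k] {A : Matrix m n R} {r : k → m} {c : k ≃ n}
    (h : (A.submatrix r c).det ≠ 0) : LinearIndependent R A.col :=
  (linearIndependent_equiv c).1 <|
    (Matrix.linearIndependent_cols_of_det_ne_zero h).of_comp (LinearMap.funLeft R R r)

end LinearAlgebra

theorem apply_eq_of_sameCycle {α β : Type*} {σ : Equiv.Perm α} {g : α → β}
    (hg : ∀ x, g (σ x) = g x) {x y : α} (h : σ.SameCycle x y) : g x = g y := by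
  obtain ⟨n, rfl⟩ := h
  induction n with
  | zero => rfl
  | succ n ih => rw [ih, add_comm, zpow_one_add, Equiv.Perm.mul_apply, hg]
  | pred n ih => rw [ih, ← hg ((σ ^ (-(n : ℤ) - 1)) x), ← Equiv.Perm.mul_apply, ← zpow_one_add,
      add_sub_cancel]

namespace DirectedMultigraph

section ExtendByZero

variable {E R : Type*} [CommRing R]

/-- Extension of a vector on the edges outside `T` by zero on `T`. -/
noncomputable def extendByZero (R : Type*) [CommRing R] (T : Finset E) :
    ({e // e ∉ T} → R) →ₗ[R] (E → R) :=
  Function.ExtendByZero.linearMap R Subtype.val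

variable {T : Finset E}

theorem extendByZero_apply_of_mem (w : {e // e ∉ T} → R) {e : E} (he : e ∈ T) :
    extendByZero R T w e = 0 :=
  Function.extend_apply' _ _ _ (by rintro ⟨e, rfl⟩; exact e.2 he)

@[simp]
theorem extendByZero_apply_coe (w : {e // e ∉ T} → R) (e : {e // e ∉ T}) :
    extendByZero R T w e = w e :=
  Subtype.val_injective.extend_apply _ _ _

theorem extendByZero_injective : Function.Injective (extendByZero R T) := fun w w' h =>
  funext fun e => by simpa using congrFun h e

theorem mem_range_extendByZero {c : E → R} :
    c ∈ LinearMap.range (extendByZero R T) ↔ ∀ e ∈ T, c e = 0 := by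
  constructor
  · rintro ⟨w, rfl⟩ e he
    exact extendByZero_apply_of_mem w he
  · refine fun hc => ⟨fun e => c e, funext fun e => ?_⟩
    by_cases he : e ∈ T
    · rw [extendByZero_apply_of_mem _ he, hc e he]
    · exact extendByZero_apply_coe _ ⟨e, he⟩

theorem extendByZero_mul (w : {e // e ∉ T} → R) (b : E → R) :
    extendByZero R T (w * fun e => b e.1) = extendByZero R T w * b := by
  funext e
  by_cases he : e ∈ T
  · simp [extendByZero_apply_of_mem _ he]
  · lift e to {e // e ∉ T} using he
    simp

theorem mulVec_extendByZero {m : Type*} [Fintype E] [DecidableEq E] (A : Matrix m E R)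
    (w : {e // e ∉ T} → R) :
    A.mulVec (extendByZero R T w) = (A.submatrix id Subtype.val).mulVec w := by
  funext i
  refine (Fintype.sum_of_injective _ Subtype.val_injective _ _ (fun e he => ?_) fun e => ?_).symm
  · rw [extendByZero_apply_of_mem _ (by simpa using he), mul_zero]
  · rw [extendByZero_apply_coe]
    rfl

end ExtendByZero

section Coboundary

variable {V E R K : Type*} [CommRing R] [Field K] {G : DirectedMultigraph V E}

theorem Connected.apply_eq {α : Type*} (hG : G.Connected) {h : V → α}
    (hh : ∀ e, h (G.src e) = h (G.tgt e)) (u v : V) : h u = h v := by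
  induction hG.2 u v with
  | rel x y hxy => obtain ⟨e, rfl, rfl⟩ := hxy; exact hh e
  | refl x => rfl
  | symm x y _ ih => exact ih.symm
  | trans x y z _ _ ih₁ ih₂ => exact ih₁.trans ih₂

theorem mk_src_eq_mk_tgt {T : Finset E} {e : E} (he : e ∈ T) :
    (Quot.mk _ (G.src e) : G.ContractVertex T) = Quot.mk _ (G.tgt e) :=
  Quot.sound ⟨e, he, rfl, rfl⟩

theorem Connected.contract (hG : G.Connected) (T : Finset E) : (G.contract T).Connected := by
  refine ⟨hG.1.map (Quot.mk _), ?_⟩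
  rintro ⟨u⟩ ⟨v⟩
  refine Quot.eqvGen_exact (hG.apply_eq (h := fun v => Quot.mk _ (Quot.mk _ v)) (fun e => ?_) u v)
  by_cases he : e ∈ T
  · rw [mk_src_eq_mk_tgt he]
  · exact Quot.sound ⟨⟨e, he⟩, rfl, rfl⟩

/-- The coboundary map, which sends a potential on the vertices to its differences along the
edges. The sign is chosen to agree with `IsSpline`: initial minus terminal vertex. -/
def coboundary (R : Type*) [CommRing R] (G : DirectedMultigraph V E) : (V → R) →ₗ[R] (E → R) :=
  LinearMap.funLeft R R G.src - LinearMap.funLeft R R G.tgt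

@[simp]
theorem coboundary_apply (p : V → R) (e : E) :
    G.coboundary R p e = p (G.src e) - p (G.tgt e) := rfl

theorem Connected.ker_coboundary (hG : G.Connected) :
    LinearMap.ker (G.coboundary R) = R ∙ (1 : V → R) := by
  ext p
  rw [LinearMap.mem_ker, Submodule.mem_span_singleton]
  constructor
  · intro hp
    obtain ⟨v⟩ := hG.1
    refine ⟨p v, funext fun u => ?_⟩
    simpa using hG.apply_eq (fun e => sub_eq_zero.1 (congrFun hp e)) v u
  · rintro ⟨c, rfl⟩
    funext e
    simp

theorem Connected.finrank_range_coboundary [Finite V] (hG : G.Connected) :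
    Module.finrank K (LinearMap.range (G.coboundary K)) + 1 = Nat.card V := by
  have := Fintype.ofFinite V
  have := hG.1
  have h := LinearMap.finrank_range_add_finrank_ker (G.coboundary K)
  rwa [hG.ker_coboundary, finrank_span_singleton one_ne_zero, Module.finrank_pi,
    ← Nat.card_eq_fintype_card] at h

theorem range_coboundary_contract (T : Finset E) :
    LinearMap.range ((G.contract T).coboundary R) =
      (LinearMap.range (G.coboundary R)).comap (extendByZero R T) := by
  ext w
  constructor
  · rintro ⟨q, rfl⟩
    refine ⟨fun v => q (Quot.mk _ v), funext fun e => ?_⟩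
    by_cases he : e ∈ T
    · rw [extendByZero_apply_of_mem _ he, coboundary_apply, mk_src_eq_mk_tgt he, sub_self]
    · exact (extendByZero_apply_coe ((G.contract T).coboundary R q) ⟨e, he⟩).symm
  · rintro ⟨p, hp⟩
    have hconst : ∀ u v, (∃ e ∈ T, G.src e = u ∧ G.tgt e = v) → p u = p v := by
      rintro _ _ ⟨e, he, rfl, rfl⟩
      exact sub_eq_zero.1 ((congrFun hp e).trans (extendByZero_apply_of_mem w he))
    exact ⟨Quot.lift p hconst, funext fun e =>
      (congrFun hp e).trans (extendByZero_apply_coe w e)⟩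

/-- The edge vectors `c` for which `c`, `c * a` and `c * a ^ 2` are coboundaries. They are the
vectors of quotients `c e = (p u - p v) / (x + a e * y) ^ 2` of homogeneous quadratic splines `p`,
and at the same time the kernel of the extended cycle basis matrix of a plane graph. -/
def splineCoeffs (G : DirectedMultigraph V E) (a : E → R) : Submodule R (E → R) :=
  ⨅ i : Fin 3, (LinearMap.range (G.coboundary R)).comap (LinearMap.mulRight R (a ^ (i : ℕ)))

theorem mem_splineCoeffs {a c : E → R} :
    c ∈ G.splineCoeffs a ↔ ∀ i : Fin 3, c * a ^ (i : ℕ) ∈ LinearMap.range (G.coboundary R) := by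
  simp [splineCoeffs]

theorem splineCoeffs_contract (T : Finset E) (a : E → R) :
    (G.contract T).splineCoeffs (fun e => a e) = (G.splineCoeffs a).comap (extendByZero R T) := by
  ext w
  simp only [mem_splineCoeffs, Submodule.mem_comap, range_coboundary_contract]
  refine forall_congr' fun i => ?_
  rw [← extendByZero_mul]
  rfl

end Coboundary

namespace PlaneEmbedding

variable {V E F R K : Type*} [CommRing R] [Field K] {G : DirectedMultigraph V E}

theorem origin_rot (P : G.PlaneEmbedding F) (d : E × Bool) :
    G.origin (P.rot d) = G.origin d :=
  ((P.rot_sameCycle_iff _ _).1 (Equiv.Perm.SameCycle.refl P.rot d).apply_right).symm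

theorem face_rot_rev (P : G.PlaneEmbedding F) (d : E × Bool) :
    P.face (P.rot (rev d)) = P.face d :=
  ((P.face_sameCycle_iff _ _).1 (Equiv.Perm.SameCycle.refl (P.rot * rev) d).apply_right).symm

/-- The dual graph is connected, phrased for functions on its vertices. -/
theorem apply_face_eq {α : Type*} (P : G.PlaneEmbedding F) {μ : Option F → α}
    (hμ : ∀ e, μ (P.face (e, true)) = μ (P.face (e, false))) (d d' : E × Bool) :
    μ (P.face d) = μ (P.face d') := by
  have hrev (d : E × Bool) : μ (P.face (rev d)) = μ (P.face d) := by
    obtain ⟨e, _ | _⟩ := d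
    exacts [hμ e, (hμ e).symm]
  have hrot (d : E × Bool) : μ (P.face (P.rot d)) = μ (P.face d) := by
    obtain ⟨d, rfl⟩ := rev.surjective d
    rw [P.face_rot_rev, hrev]
  have hfactors : (μ ∘ P.face).FactorsThrough G.origin := fun _ _ h =>
    apply_eq_of_sameCycle hrot ((P.rot_sameCycle_iff _ _).2 h)
  have hextend := hfactors.extend_apply fun _ => μ none
  have hconst := P.connected.apply_eq (h := Function.extend G.origin (μ ∘ P.face) fun _ => μ none)
    (fun e => (hextend (e, true)).trans ((hμ e).trans (hextend (e, false)).symm))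
  exact (hextend d).symm.trans ((hconst _ _).trans (hextend d'))

variable [DecidableEq F]

theorem linearIndependent_row_cycleMatrix [Finite F] (P : G.PlaneEmbedding F) :
    LinearIndependent R (P.cycleMatrix.map (Int.cast : ℤ → R)).row := by
  have := Fintype.ofFinite F
  rw [Fintype.linearIndependent_iff]
  intro c hc f
  let μ : Option F → R := fun o => o.elim 0 c
  have hsum (o : Option F) : ∑ f, c f * (if o = some f then 1 else 0) = μ o := by
    cases o <;> simp [μ]
  have hedge (e : E) : μ (P.face (e, true)) = μ (P.face (e, false)) := by
    rw [← sub_eq_zero, ← hsum, ← hsum, ← Finset.sum_sub_distrib]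
    simpa [cycleMatrix, mul_sub] using congrFun hc e
  obtain ⟨d, hd⟩ := P.exists_face_eq_some f
  obtain ⟨d', hd'⟩ := P.exists_face_eq_none ⟨d.1⟩
  simpa [μ, hd, hd'] using P.apply_face_eq hedge d d'

theorem cycleMatrix_mulVec_coboundary [Fintype E] (P : G.PlaneEmbedding F) (p : V → R) :
    (P.cycleMatrix.map (Int.cast : ℤ → R)).mulVec (G.coboundary R p) = 0 := by
  funext f
  -- the boundary walk of `f` starts as often at a given vertex as it arrives there
  have hwalk : ∑ d : E × Bool, (if P.face d = some f then p (G.origin d) else 0) =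
      ∑ d : E × Bool, (if P.face d = some f then p (G.origin (rev d)) else 0) := by
    rw [← Equiv.sum_comp (P.rot * rev : Equiv.Perm (E × Bool))]
    simp only [Equiv.Perm.mul_apply, origin_rot, face_rot_rev]
  rw [← sub_eq_zero, ← Finset.sum_sub_distrib, Fintype.sum_prod_type] at hwalk
  rw [Pi.zero_apply, ← hwalk]
  refine Finset.sum_congr rfl fun e _ => ?_
  simp only [Fintype.sum_bool, Matrix.map_apply, cycleMatrix, coboundary_apply, origin, rev,
    Equiv.prodCongr_apply, Prod.map, Equiv.refl_apply, Equiv.boolNot_apply, Bool.not_true,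
    Bool.not_false, if_true, Bool.false_eq_true, if_false]
  split_ifs <;> push_cast <;> ring

theorem ker_cycleMatrix [Finite V] [Fintype E] [Finite F] (P : G.PlaneEmbedding F) :
    LinearMap.ker (P.cycleMatrix.map (Int.cast : ℤ → K)).mulVecLin =
      LinearMap.range (G.coboundary K) := by
  have := Fintype.ofFinite F
  symm
  apply Submodule.eq_of_le_of_finrank_eq
  · rintro _ ⟨p, rfl⟩
    exact P.cycleMatrix_mulVec_coboundary p
  · have hrange := P.connected.finrank_range_coboundary (K := K)
    have hker := rank_add_finrank_ker_mulVecLin (P.cycleMatrix.map (Int.cast : ℤ → K))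
    have hrank := (P.linearIndependent_row_cycleMatrix (R := K)).rank_matrix
    have heuler := P.euler
    rw [Nat.card_eq_fintype_card (α := E), Nat.card_eq_fintype_card (α := F)] at heuler
    omega

theorem extMatrix_mulVec [Fintype E] (P : G.PlaneEmbedding F) (a c : E → R) (i : F × Fin 3) :
    (P.extMatrix a).mulVec c i =
      (P.cycleMatrix.map (Int.cast : ℤ → R)).mulVec (c * a ^ (i.2 : ℕ)) i.1 := by
  simp only [Matrix.mulVec, dotProduct, extMatrix, Matrix.map_apply, Pi.mul_apply, Pi.pow_apply]
  exact Finset.sum_congr rfl fun e _ => by ring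

theorem ker_extMatrix [Finite V] [Fintype E] [Finite F] (P : G.PlaneEmbedding F) (a : E → K) :
    LinearMap.ker (P.extMatrix a).mulVecLin = G.splineCoeffs a := by
  ext c
  simp only [mem_splineCoeffs, ← P.ker_cycleMatrix, LinearMap.mem_ker, Matrix.mulVecLin_apply,
    funext_iff, Prod.forall, extMatrix_mulVec, Pi.zero_apply]
  exact forall_comm

section Blocks

variable [Fintype E]

theorem extMatrix_eq_zero (P : G.PlaneEmbedding F) {S : Finset F} (a : E → R) {f : F}
    (hf : f ∈ S) (i : Fin 3) {e : E} (he : e ∉ P.boundaryEdges S) :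
    P.extMatrix a (f, i) e = 0 := by
  have h (b : Bool) : P.face (e, b) ≠ some f := fun h =>
    he (Finset.mem_filter.2 ⟨Finset.mem_univ _, f, hf, b, h⟩)
  simp [extMatrix, cycleMatrix, h]

theorem submatrix_extMatrix_eq_fromBlocks (P : G.PlaneEmbedding F) (S : Finset F) (a : E → R) :
    (P.extMatrix a).submatrix
        (Sum.elim (Prod.map Subtype.val id) (Prod.map Subtype.val id) :
          ({f // f ∈ S} × Fin 3) ⊕ ({f // f ∉ S} × Fin 3) → F × Fin 3)
        (Sum.elim Subtype.val Subtype.val :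
          {e // e ∈ P.boundaryEdges S} ⊕ {e // e ∉ P.boundaryEdges S} → E) =
      Matrix.fromBlocks (P.innerBlock S a) 0
        ((P.extMatrix a).submatrix (Prod.map Subtype.val id) Subtype.val)
        (P.outerBlock S a) := by
  ext (i | i) (e | e)
  · rfl
  · exact P.extMatrix_eq_zero a i.1.2 i.2 e.2
  · rfl
  · rfl

theorem innerBlock_mulVec (P : G.PlaneEmbedding F) (S : Finset F) (a c : E → R) :
    (P.innerBlock S a).mulVec (fun e => c e) =
      fun i => (P.extMatrix a).mulVec c (Prod.map Subtype.val id i) := by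
  funext i
  refine Fintype.sum_of_injective _ Subtype.val_injective _ _ (fun e he => ?_) fun _ => rfl
  exact mul_eq_zero_of_left (P.extMatrix_eq_zero a i.1.2 i.2 (by simpa using he)) _

theorem GenericLabels.linearIndependent_col_innerBlock [IsDomain R] {P : G.PlaneEmbedding F}
    {S : Finset F} {a : E → R} (hgen : P.GenericLabels S a)
    (hS : (P.boundaryEdges S).card ≤ 3 * S.card) :
    LinearIndependent R (P.innerBlock S a).col := by
  obtain ⟨r, c, -, hdet⟩ := hgen
  have heval : (P.innerBlock S (MvPolynomial.X : E → MvPolynomial E R)).map (MvPolynomial.eval a) =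
      P.innerBlock S a := by
    ext i e
    simp [innerBlock, extMatrix]
  rw [RingHom.map_det, RingHom.mapMatrix_apply, ← Matrix.submatrix_map, heval] at hdet
  have hc : Function.Bijective c := by
    rw [Fintype.bijective_iff_injective_and_card]
    exact ⟨c.injective, by simp [hS]⟩
  exact linearIndependent_col_of_det_submatrix_ne_zero (c := Equiv.ofBijective c hc) hdet

theorem ker_extMatrix_le_range_extendByZero {P : G.PlaneEmbedding F} {S : Finset F} {a : E → R}
    (hcol : LinearIndependent R (P.innerBlock S a).col) :
    LinearMap.ker (P.extMatrix a).mulVecLin ≤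
      LinearMap.range (extendByZero R (P.boundaryEdges S)) := by
  intro c hc
  have hinner : (P.innerBlock S a).mulVec (fun e => c e) = (P.innerBlock S a).mulVec 0 := by
    rw [innerBlock_mulVec, Matrix.mulVec_zero]
    exact funext fun i => congrFun hc _
  have hzero := Matrix.mulVec_injective_iff.2 hcol hinner
  exact mem_range_extendByZero.2 fun e he => congrFun hzero ⟨e, he⟩

variable [DecidableEq E]

theorem ker_outerBlock (P : G.PlaneEmbedding F) (S : Finset F) (a : E → R) :
    LinearMap.ker (P.outerBlock S a).mulVecLin =
      (LinearMap.ker (P.extMatrix a).mulVecLin).comap (extendByZero R (P.boundaryEdges S)) := by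
  ext w
  simp only [Submodule.mem_comap, LinearMap.mem_ker, Matrix.mulVecLin_apply, mulVec_extendByZero]
  refine ⟨fun h => funext fun ⟨f, i⟩ => ?_, fun h => funext fun i => congrFun h _⟩
  by_cases hf : f ∈ S
  · exact Finset.sum_eq_zero fun e _ =>
      mul_eq_zero_of_left (P.extMatrix_eq_zero a hf i e.2) _
  · exact congrFun h (⟨f, hf⟩, i)

theorem rank_extMatrix_eq_add (P : G.PlaneEmbedding F) {S : Finset F} {a : E → K}
    (hcol : LinearIndependent K (P.innerBlock S a).col) :
    (P.extMatrix a).rank = (P.innerBlock S a).rank + (P.outerBlock S a).rank := by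
  have hext := rank_add_finrank_ker_mulVecLin (P.extMatrix a)
  have houter := rank_add_finrank_ker_mulVecLin (P.outerBlock S a)
  have hcard := Fintype.card_congr (Equiv.sumCompl (· ∈ P.boundaryEdges S))
  rw [ker_outerBlock, finrank_comap_eq_of_le_range extendByZero_injective
    (ker_extMatrix_le_range_extendByZero hcol)] at houter
  rw [Fintype.card_sum, ← rank_eq_card_of_linearIndependent_col hcol] at hcard
  omega

theorem rank_extMatrix_contract [Finite V] [Finite F] {F' : Type*} [Finite F'] [DecidableEq F']
    (P : G.PlaneEmbedding F) (S : Finset F) (a : E → K)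
    (Q : (G.contract (P.boundaryEdges S)).PlaneEmbedding F') :
    (Q.extMatrix fun e => a e).rank = (P.outerBlock S a).rank := by
  have hQ := rank_add_finrank_ker_mulVecLin (Q.extMatrix fun e => a e)
  have hP := rank_add_finrank_ker_mulVecLin (P.outerBlock S a)
  rw [Q.ker_extMatrix, splineCoeffs_contract, ← P.ker_extMatrix, ← P.ker_outerBlock] at hQ
  omega

end Blocks

end PlaneEmbedding

section Splines

open MvPolynomial

theorem exists_eq_C_mul_of_dvd {σ R : Type*} [CommRing R] [IsDomain R] {n : ℕ}
    {f p : MvPolynomial σ R} (hf : f.IsHomogeneous n) (hp : p.IsHomogeneous n) (h : f ∣ p) :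
    ∃ c, p = C c * f := by
  obtain ⟨q, rfl⟩ := h
  by_cases hfq : f * q = 0
  · exact ⟨0, by simp [hfq]⟩
  have hf0 := left_ne_zero_of_mul hfq
  have hdeg := totalDegree_mul_of_isDomain hf0 (right_ne_zero_of_mul hfq)
  rw [hp.totalDegree hfq, hf.totalDegree hf0, left_eq_add, totalDegree_eq_zero_iff_eq_C] at hdeg
  exact ⟨_, by rw [mul_comm, hdeg]⟩

/-- The binary quadratic form `q 0 * x ^ 2 + 2 * q 1 * x * y + q 2 * y ^ 2`. -/
noncomputable def quadForm (R : Type*) [CommRing R] :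
    (Fin 3 → R) →ₗ[R] MvPolynomial (Fin 2) R :=
  Fintype.linearCombination R ![X 0 ^ 2, 2 * (X 0 * X 1), X 1 ^ 2]

variable {V E R K : Type*} [CommRing R] [Field K]

theorem quadForm_apply (q : Fin 3 → R) :
    quadForm R q = C (q 0) * X 0 ^ 2 + C (q 1) * (2 * (X 0 * X 1)) + C (q 2) * X 1 ^ 2 := by
  simp [quadForm, Fintype.linearCombination_apply, Fin.sum_univ_three, smul_eq_C_mul]

theorem quadForm_isHomogeneous (q : Fin 3 → R) : (quadForm R q).IsHomogeneous 2 := by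
  have hX (i : Fin 2) := isHomogeneous_X R i
  rw [quadForm_apply, ← map_ofNat C]
  exact ((((hX 0).pow 2).C_mul _).add ((((hX 0).mul (hX 1)).C_mul _).C_mul _)).add
    (((hX 1).pow 2).C_mul _)

theorem quadForm_mul_pow (a : E → R) (e : E) (c : R) :
    quadForm R (fun i => c * a e ^ (i : ℕ)) = C c * squareLabel a e := by
  simp only [quadForm_apply, squareLabel, map_mul, map_pow, Fin.val_zero, Fin.val_one, Fin.val_two]
  ring

theorem squareLabel_isHomogeneous (a : E → R) (e : E) : (squareLabel a e).IsHomogeneous 2 := by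
  have h := quadForm_mul_pow a e 1
  rw [C_1, one_mul] at h
  exact h ▸ quadForm_isHomogeneous _

/-- The inverse of `quadForm` on binary quadratic forms if `2 ≠ 0`, by polarization. -/
noncomputable def quadCoeff (K : Type*) [Field K] : Fin 3 → MvPolynomial (Fin 2) K →ₗ[K] K :=
  let evalAt (x y : K) := (aeval ![x, y] : MvPolynomial (Fin 2) K →ₐ[K] K).toLinearMap
  ![evalAt 1 0, (2 : K)⁻¹ • (evalAt 1 1 - evalAt 1 0 - evalAt 0 1), evalAt 0 1]

theorem quadCoeff_quadForm (h2 : (2 : K) ≠ 0) (q : Fin 3 → K) (i : Fin 3) :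
    quadCoeff K i (quadForm K q) = q i := by
  have hmid : q 0 + q 1 * 2 + q 2 - q 0 - q 2 = 2 * q 1 := by ring
  fin_cases i <;> simp [quadCoeff, quadForm_apply, hmid, h2]

theorem quadCoeff_C_mul_squareLabel (h2 : (2 : K) ≠ 0) (a : E → K) (e : E) (c : K) (i : Fin 3) :
    quadCoeff K i (C c * squareLabel a e) = c * a e ^ (i : ℕ) := by
  rw [← quadForm_mul_pow, quadCoeff_quadForm h2]

/-- The quotients of the differences of a homogeneous quadratic spline along the edges by the edge
labels, encoded as the values of the differences at `(1, 0)`, where the edge labels have value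
`1`. -/
noncomputable def edgeQuotient (R : Type*) [CommRing R] (G : DirectedMultigraph V E) :
    (V → MvPolynomial (Fin 2) R) →ₗ[R] (E → R) :=
  G.coboundary R ∘ₗ (aeval ![(1 : R), 0]).toLinearMap.compLeft V

variable {G : DirectedMultigraph V E} {v₀ : V}

theorem edgeQuotient_apply_of_sub_eq {p : V → MvPolynomial (Fin 2) R} {a : E → R} {e : E} {c : R}
    (h : p (G.src e) - p (G.tgt e) = C c * squareLabel a e) : G.edgeQuotient R p e = c := by
  simpa [edgeQuotient, squareLabel] using congrArg (aeval ![(1 : R), 0]) h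

theorem sub_eq_edgeQuotient_mul_squareLabel [IsDomain R] {a : E → R}
    {p : V → MvPolynomial (Fin 2) R} (hp : p ∈ G.splineSpace 2 (squareLabel a) v₀) (e : E) :
    p (G.src e) - p (G.tgt e) = C (G.edgeQuotient R p e) * squareLabel a e := by
  obtain ⟨c, hc⟩ := exists_eq_C_mul_of_dvd (squareLabel_isHomogeneous a e)
    ((hp.1 _).sub (hp.1 _)) (hp.2.1 e)
  rw [edgeQuotient_apply_of_sub_eq hc, hc]

theorem map_edgeQuotient_splineSpace (h2 : (2 : K) ≠ 0) (a : E → K) (v₀ : V) :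
    (G.splineSpace 2 (squareLabel a) v₀).map (G.edgeQuotient K) = G.splineCoeffs a := by
  ext c
  rw [mem_splineCoeffs]
  constructor
  · rintro ⟨p, hp, rfl⟩ i
    refine ⟨fun v => quadCoeff K i (p v), funext fun e => ?_⟩
    rw [coboundary_apply, ← map_sub, sub_eq_edgeQuotient_mul_squareLabel hp,
      quadCoeff_C_mul_squareLabel h2, Pi.mul_apply, Pi.pow_apply]
  · intro hc
    choose q hq using hc
    let p : V → MvPolynomial (Fin 2) K := fun v => quadForm K fun i => q i v - q i v₀
    have hsub (e : E) : p (G.src e) - p (G.tgt e) = C (c e) * squareLabel a e := by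
      rw [← map_sub, ← quadForm_mul_pow]
      congr 1
      funext i
      simpa using congrFun (hq i) e
    refine ⟨p, ⟨fun v => quadForm_isHomogeneous _, fun e => ⟨C (c e), ?_⟩, ?_⟩, funext fun e => ?_⟩
    · rw [hsub, mul_comm]
    · simp only [p, sub_self]
      exact map_zero _
    · exact edgeQuotient_apply_of_sub_eq (hsub e)

theorem Connected.injective_edgeQuotient_domRestrict [IsDomain R] (hG : G.Connected)
    (a : E → R) (v₀ : V) :
    Function.Injective
      ((G.edgeQuotient R).domRestrict (G.splineSpace 2 (squareLabel a) v₀)) := by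
  refine (injective_iff_map_eq_zero _).2 fun ⟨p, hp⟩ h => Subtype.ext (funext fun v => ?_)
  refine (hG.apply_eq (fun e => ?_) v v₀).trans hp.2.2
  have he : G.edgeQuotient R p e = 0 := congrFun h e
  rw [← sub_eq_zero, sub_eq_edgeQuotient_mul_squareLabel hp, he, C_0, zero_mul]

theorem Connected.finrank_splineSpace (hG : G.Connected) (h2 : (2 : K) ≠ 0) (a : E → K)
    (v₀ : V) :
    Module.finrank K (G.splineSpace 2 (squareLabel a) v₀) =
      Module.finrank K (G.splineCoeffs a) := by
  rw [← map_edgeQuotient_splineSpace h2 a v₀, ← LinearMap.range_domRestrict,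
    LinearMap.finrank_range_of_inj (hG.injective_edgeQuotient_domRestrict a v₀)]

theorem PlaneEmbedding.finrank_splineSpace_contract {F : Type*} [Finite V] [Fintype E] [Finite F]
    [DecidableEq F] (P : G.PlaneEmbedding F) {S : Finset F} (h2 : (2 : K) ≠ 0)
    {a : E → K} (hcol : LinearIndependent K (P.innerBlock S a).col) (v₀ : V) :
    Module.finrank K ((G.contract (P.boundaryEdges S)).splineSpace 2
        (squareLabel fun e => a e) (Quot.mk _ v₀)) =
      Module.finrank K (G.splineSpace 2 (squareLabel a) v₀) := by
  rw [(P.connected.contract _).finrank_splineSpace h2, P.connected.finrank_splineSpace h2,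
    splineCoeffs_contract, finrank_comap_eq_of_le_range extendByZero_injective]
  exact P.ker_extMatrix a ▸ ker_extMatrix_le_range_extendByZero hcol

end Splines

end DirectedMultigraph

theorem mainTheorem8_general {V E F K : Type*} [Field K] [Finite V] [Fintype E] [Finite F]
    [DecidableEq E] [DecidableEq F]
    (G : DirectedMultigraph V E) (P : G.PlaneEmbedding F) (a : E → K) (v₀ : V)
    (S : Finset F) (h2 : (2 : K) ≠ 0) (hcol : LinearIndependent K (P.innerBlock S a).col) :
    (∃ B : Matrix ({f // f ∉ S} × Fin 3) {e // e ∈ P.boundaryEdges S} K,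
      (P.extMatrix a).submatrix
          (Sum.elim (Prod.map Subtype.val id) (Prod.map Subtype.val id) :
            ({f // f ∈ S} × Fin 3) ⊕ ({f // f ∉ S} × Fin 3) → F × Fin 3)
          (Sum.elim Subtype.val Subtype.val :
            {e // e ∈ P.boundaryEdges S} ⊕ {e // e ∉ P.boundaryEdges S} → E) =
        Matrix.fromBlocks (P.innerBlock S a) 0 B (P.outerBlock S a)) ∧
    (P.extMatrix a).rank = (P.innerBlock S a).rank + (P.outerBlock S a).rank ∧
    (∀ (F' : Type*) [Finite F'] [DecidableEq F']
      (Q : (G.contract (P.boundaryEdges S)).PlaneEmbedding F'),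
      (P.extMatrix a).rank =
        (P.innerBlock S a).rank + (Q.extMatrix fun e => a e.1).rank) ∧
    Module.finrank K (G.splineSpace 2 (DirectedMultigraph.squareLabel a) v₀) =
      Module.finrank K ((G.contract (P.boundaryEdges S)).splineSpace 2
        (DirectedMultigraph.squareLabel fun e => a e.1) (Quot.mk _ v₀)) := by
  have hrank := P.rank_extMatrix_eq_add hcol
  refine ⟨⟨_, P.submatrix_extMatrix_eq_fromBlocks S a⟩, hrank, fun F' _ _ Q => ?_, ?_⟩
  · rw [hrank, P.rank_extMatrix_contract S a Q]
  · exact (P.finrank_splineSpace_contract h2 hcol v₀).symm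

theorem mainTheorem8 {V E F : Type*} [Fintype V] [Fintype E] [Fintype F]
    [DecidableEq E] [DecidableEq F]
    (G : DirectedMultigraph V E) (P : G.PlaneEmbedding F) (a : E → ℂ) (v₀ : V)
    (S : Finset F) (hS : (P.boundaryEdges S).card ≤ 3 * S.card) (hgen : P.GenericLabels S a) :
    -- the block-triangular form
    (∃ B : Matrix ({f // f ∉ S} × Fin 3) {e // e ∈ P.boundaryEdges S} ℂ,
      (P.extMatrix a).submatrix
          (Sum.elim (Prod.map Subtype.val id) (Prod.map Subtype.val id) :
            ({f // f ∈ S} × Fin 3) ⊕ ({f // f ∉ S} × Fin 3) → F × Fin 3)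
          (Sum.elim Subtype.val Subtype.val :
            {e // e ∈ P.boundaryEdges S} ⊕ {e // e ∉ P.boundaryEdges S} → E) =
        Matrix.fromBlocks (P.innerBlock S a) 0 B (P.outerBlock S a)) ∧
    (P.extMatrix a).rank = (P.innerBlock S a).rank + (P.outerBlock S a).rank ∧
    -- additivity of the rank, for every plane embedding of the contracted graph
    (∀ (F' : Type*) [Fintype F'] [DecidableEq F']
      (Q : (G.contract (P.boundaryEdges S)).PlaneEmbedding F'),
      (P.extMatrix a).rank =
        (P.innerBlock S a).rank + (Q.extMatrix fun e => a e.1).rank) ∧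
    -- contraction does not change the dimension
    Module.finrank ℂ (G.splineSpace 2 (DirectedMultigraph.squareLabel a) v₀) =
      Module.finrank ℂ ((G.contract (P.boundaryEdges S)).splineSpace 2
        (DirectedMultigraph.squareLabel fun e => a e.1) (Quot.mk _ v₀)) :=
  let ⟨hblocks, hrank, hcontract, hfinrank⟩ := mainTheorem8_general G P a v₀ S two_ne_zero
    (hgen.linearIndependent_col_innerBlock hS)
  ⟨hblocks, hrank, fun F' _ _ Q => hcontract F' Q, hfinrank⟩
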